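/- Let $f:\{0,1\}^m\times\{0,1\}^n\to\{0,1\}$ be a total function with communication matrix $M[x,y]=f(x,y)$. **Protocols.** In a quantum one-way protocol (without prior entanglement) Alice, on input $x$, applies a unitary transformation depending on $x$ to finitely many private qubits initialized to $|0\rangle$ and sends $C$ of them to Bob. Bob, on input $y$, applies a unitary transformation depending on $y$ to the received qubits together with finitely many private qubits initialized to $|0\rangle$; one fixed qubit of his is then measured in the computational basis, and the result is the output. Let $Q^1_\epsilon(f)$ be the least number $C$ of communicated qubits of such a protocol whose output equals $f(x,y)$ with probability at least $1-\epsilon$ for all inputs $x,y$. **The bound.** For a set $M'$ of at least three different rows of $M$ write $row(M')$ for their number. Let $h=h(M')$ be the minimal number with the following property: for every subset $M''$ of $M'$ that contains at least two rows and is obtained by fixing the entries of the rows in some (possibly no) columns, there is a column $c$ such that $$\max\Big\{\frac{U}{U+V},\frac{V}{U+V}\Big\}\le h,$$ where $U$ and $V$ are the numbers of ones and of zeroes in column $c$ over the rows in $M''$. (Then $1/2\le h<1$ and $\log_{1/h} row(M')\geq \log_2 3>1$.) Let $$bound(f)=\max_{M'}\ \frac{\log_2 row(M')}{\log_2\log_{1/h(M')}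 row(M')},$$ the maximum being over all sets $M'$ of at least three different rows of $M$; put $bound(f)=0$ if $M$ has at most two different rows. **Theorem 2.** $Q^1_\epsilon(f)=\Omega(bound(f))$ for all total $f$: for every $\epsilon$ with $0<\epsilon<1/2$ there is a constant $c>0$, depending only on $\epsilon$, such that for all $m,n\ge 0$ and all $f:\{0,1\}^m\times\{0,1\}^n\to\{0,1\}$ $$Q^1_\epsilon(f)\ \ge\ c\cdot bound(f).$$ -/

import Mathlib

open scoped Kronecker

/-- Bit strings of length `n`. They serve as inputs and as the labels of the computational basis
of `n` qubits. -/
abbrev Bits (n : ℕ) : Type := Fin n → Bool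

/-- The all-zero bit string. -/
def zeroBits (n : ℕ) : Bits n := fun _ => false

/-- A quantum one-way protocol with message length `C` (in qubits) and without prior entanglement.
On input `x` Alice applies the unitary `alice x` to her `keep + C` private qubits, which are
initialized to `|0⟩`, and sends the last `C` of them to Bob. On input `y` Bob applies the unitary
`bob y` to the `C` received qubits together with his `work` private qubits, which are initialized
to `|0⟩`. Finally his qubit number `out` is measured in the computational basis, and the result is
the output. -/
structure OneWayProtocol (X Y : Type) (C : ℕ) where
  /-- the number of qubits that Alice keeps -/
  keep : ℕ
  /-- the number of Bob's private qubits -/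
  work : ℕ
  /-- Alice's unitary transformation -/
  alice : X → Matrix.unitaryGroup (Bits keep × Bits C) ℂ
  /-- Bob's unitary transformation -/
  bob : Y → Matrix.unitaryGroup (Bits C × Bits work) ℂ
  /-- the qubit of Bob that is measured -/
  out : Fin C ⊕ Fin work

namespace OneWayProtocol

variable {X Y : Type} {C : ℕ}

/-- The state of Alice's qubits after her transformation of `|0…0⟩`. -/
noncomputable def aliceState (P : OneWayProtocol X Y C) (x : X) : Bits P.keep × Bits C → ℂ :=
  (P.alice x : Matrix (Bits P.keep × Bits C) (Bits P.keep × Bits C) ℂ).mulVec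
    (Pi.single (zeroBits P.keep, zeroBits C) 1)

/-- The state of all qubits when Bob has received the message and has not yet acted: the tensor
product of Alice's state with `|0…0⟩` on Bob's private qubits. -/
noncomputable def sentState (P : OneWayProtocol X Y C) (x : X) :
    Bits P.keep × (Bits C × Bits P.work) → ℂ :=
  fun s => P.aliceState x (s.1, s.2.1) *
    (Pi.single (zeroBits P.work) 1 : Bits P.work → ℂ) s.2.2

/-- The final state: Bob's transformation acts on the message and on his private qubits, and the
identity acts on the qubits that Alice has kept. -/
noncomputable def finalState (P : OneWayProtocol X Y C) (x : X) (y : Y) :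
    Bits P.keep × (Bits C × Bits P.work) → ℂ :=
  ((1 : Matrix (Bits P.keep) (Bits P.keep) ℂ) ⊗ₖ
    (P.bob y : Matrix (Bits C × Bits P.work) (Bits C × Bits P.work) ℂ)).mulVec (P.sentState x)

/-- The value of the output qubit in a basis state. -/
def outBit (P : OneWayProtocol X Y C) (s : Bits P.keep × (Bits C × Bits P.work)) : Bool :=
  Sum.elim s.2.1 s.2.2 P.out

/-- The probability that the output is `b` on the inputs `x`, `y`: the squared length of the
projection of the final state onto the span of the basis states whose output qubit is `b`. -/
noncomputable def prob (P : OneWayProtocol X Y C) (x : X) (y : Y) (b : Bool) : ℝ :=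
  ∑ s, if P.outBit s = b then ‖P.finalState x y s‖ ^ 2 else 0

/-- On all inputs the correct answer is given with probability at least `1 - ε`. -/
def Computes (P : OneWayProtocol X Y C) (ε : ℝ) (f : X → Y → Bool) : Prop :=
  ∀ x y, 1 - ε ≤ P.prob x y (f x y)

end OneWayProtocol

/-- The quantum one-way communication complexity `Q¹_ε(f)`: the least number of qubits that Alice
sends in a quantum one-way protocol that computes `f` with error at most `ε`. -/
noncomputable def quantumOneWay {m n : ℕ} (ε : ℝ) (f : Bits m → Bits n → Bool) : ℕ :=
  sInf {C : ℕ | ∃ P : OneWayProtocol (Bits m) (Bits n) C, P.Computes ε f}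

/-- The set of the (different) rows of the communication matrix `M[x, y] = f x y`. -/
def commRows {m n : ℕ} (f : Bits m → Bits n → Bool) : Finset (Bits n → Bool) :=
  Finset.univ.image f

/-- The rows in `M'` whose entries in the columns `c ∈ S` are fixed to `v c`. -/
def fixColumns {n : ℕ} (M' : Finset (Bits n → Bool)) (S : Finset (Bits n)) (v : Bits n → Bool) :
    Finset (Bits n → Bool) :=
  M'.filter fun r => ∀ c ∈ S, r c = v c

/-- The number of rows in `M''` that have the entry `b` in column `c`. -/
def countEntry {n : ℕ} (M'' : Finset (Bits n → Bool)) (c : Bits n) (b : Bool) : ℕ :=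
  (M''.filter fun r => r c = b).card

/-- `max {U / (U + V), V / (U + V)}`, where `U` and `V` are the numbers of ones and of zeroes in
column `c` over the rows in `M''`. -/
noncomputable def majorityFraction {n : ℕ} (M'' : Finset (Bits n → Bool)) (c : Bits n) : ℝ :=
  max ((countEntry M'' c true : ℝ) / (countEntry M'' c true + countEntry M'' c false))
    ((countEntry M'' c false : ℝ) / (countEntry M'' c true + countEntry M'' c false))

/-- Every subset `M''` of `M'` that is obtained by fixing the entries in some columns, and that
still has at least two rows, has a column in which each of the two values is taken by at most a
fraction `h` of the rows. -/
def SplitsWithin {n : ℕ} (M' : Finset (Bits n → Bool)) (h : ℝ) : Prop :=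
  ∀ (S : Finset (Bits n)) (v : Bits n → Bool), 2 ≤ (fixColumns M' S v).card →
    ∃ c : Bits n, majorityFraction (fixColumns M' S v) c ≤ h

/-- The minimal `h` with `SplitsWithin M' h`. -/
noncomputable def splitBalance {n : ℕ} (M' : Finset (Bits n → Bool)) : ℝ :=
  sInf {h : ℝ | SplitsWithin M' h}

theorem majorityFraction_le_one {n : ℕ} (M : Finset (Bits n → Bool)) (c : Bits n) :
    majorityFraction M c ≤ 1 := by
  unfold majorityFraction
  apply max_le <;> apply div_le_one_of_le₀ <;> first | positivity | simp

theorem majorityFraction_nonneg {n : ℕ} (M : Finset (Bits n → Bool)) (c : Bits n) :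
    0 ≤ majorityFraction M c := by
  unfold majorityFraction
  exact le_max_of_le_left (by positivity)

/-- For at least two rows the minimum in the definition of `splitBalance` is attained. -/
theorem splitBalance_isLeast {n : ℕ} (M' : Finset (Bits n → Bool)) (hM : 2 ≤ M'.card) :
    IsLeast {h : ℝ | SplitsWithin M' h} (splitBalance M') := by
  have hbdd : BddBelow {h : ℝ | SplitsWithin M' h} := by
    refine ⟨0, fun h hh => ?_⟩
    obtain ⟨c, hc⟩ := hh ∅ (fun _ => false) (by simpa [fixColumns] using hM)
    exact (majorityFraction_nonneg _ _).trans hc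
  have hne : {h : ℝ | SplitsWithin M' h}.Nonempty :=
    ⟨1, fun S v _ => ⟨zeroBits n, majorityFraction_le_one _ _⟩⟩
  have hcl : IsClosed {h : ℝ | SplitsWithin M' h} := by
    have : {h : ℝ | SplitsWithin M' h} = ⋂ (S : Finset (Bits n)) (v : Bits n → Bool)
        (_ : 2 ≤ (fixColumns M' S v).card),
        ⋃ c : Bits n, Set.Ici (majorityFraction (fixColumns M' S v) c) := by
      ext h; simp [SplitsWithin]
    rw [this]
    exact isClosed_iInter fun S => isClosed_iInter fun v => isClosed_iInter fun _ =>
      isClosed_iUnion_of_finite fun c => isClosed_Ici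
  exact ⟨hcl.csInf_mem hne hbdd, fun h hh => csInf_le hbdd hh⟩

/-- The value `log₂ row(M') / log₂ log_{1/h} row(M')`. It is meaningful for at least three rows:
then `log_{1/h} row(M') ≥ log₂ 3 > 1`. -/
noncomputable def rowsBound {n : ℕ} (M' : Finset (Bits n → Bool)) : ℝ :=
  Real.logb 2 M'.card / Real.logb 2 (Real.logb (1 / splitBalance M') M'.card)

/-- `bound(f)`: the largest value over all sets `M'` of at least three rows of the communication
matrix (and `0` if the matrix has at most two different rows). -/
noncomputable def rowBound {m n : ℕ} (f : Bits m → Bits n → Bool) : ℝ :=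
  sSup {b : ℝ | ∃ M' : Finset (Bits n → Bool), M' ⊆ commRows f ∧ 3 ≤ M'.card ∧ b = rowsBound M'}

/-! A good protocol lets Bob recover Alice's whole row, so the message must have enough dimensions
to tell the rows of `M'` apart. Write R for the number of rows and h for the balance. Always asking
for the entry in a balanced column leaves at most a fraction h of the candidate rows, so a binary
search of depth N = ⌈log_{1/h} R⌉ identifies the row (`exists_rowOperators`).

The search measures the same message repeatedly, so its answers must be nearly certain if they are
not to disturb it. Taking the majority of t parallel runs brings the error of one answer below β^t
with β = 2√(ε(1-ε)) (`sum_majorityBit_wrong_le`). Since contractions follow each projection, the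
disturbance telescopes into at most N wrong outcomes on the undisturbed state, with squared size at
most N²β^t. For t of order log N, each row is recovered with probability at least 1/2
(`half_le_success`).

The t messages lie in a space spanned by 2^(Ct) basis states, however many work qubits Bob adds, so
the success probabilities sum to at most 2^(Ct) (`sum_success_le_card`). Hence R/2 ≤ 2^(Ct), and C
is at least a constant times log R / log log_{1/h} R. -/

theorem countEntry_add {n : ℕ} (M : Finset (Bits n → Bool)) (c : Bits n) :
    (countEntry M c true : ℝ) + countEntry M c false = M.card := by
  have := Finset.card_filter_add_card_filter_not (s := M) (fun r => r c = true)
  simp only [Bool.not_eq_true] at this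
  exact_mod_cast this

/-! ### Binary search by projections, and the dimension bound -/

/-- Measuring the columns of a row along a balanced binary search: if `P c b` is the projection onto
the outcome `b` for column `c`, then there are operators `K r`, one for each row, that form a
(sub-)measurement, and `K r` is a product of at most `k` of the projections, all of them with
the outcomes that are correct for the row `r`. -/
theorem exists_rowOperators {n : ℕ} {E : Type*} [NormedAddCommGroup E] [NormedSpace ℂ E]
    (P : Bits n → Bool → E →ₗ[ℂ] E) (hsum : ∀ c b v, P c b v + P c (!b) v = v)
    (hnorm : ∀ c v, ‖P c true v‖ ^ 2 + ‖P c false v‖ ^ 2 = ‖v‖ ^ 2)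
    {M' : Finset (Bits n → Bool)} {h : ℝ} (h0 : 0 ≤ h) (hs : SplitsWithin M' h) (k : ℕ) :
    ∀ M : Finset (Bits n → Bool), (2 ≤ M.card → ∃ S v, M = fixColumns M' S v) →
      M.card * h ^ k ≤ 1 →
      ∃ K : (Bits n → Bool) → E →ₗ[ℂ] E, (∀ v, ∑ r ∈ M, ‖K r v‖ ^ 2 ≤ ‖v‖ ^ 2) ∧
        ∀ r ∈ M, ∃ cs : List (Bits n), cs.length ≤ k ∧
          ∀ v, ‖v - K r v‖ ≤ (cs.map fun c => ‖P c (!r c) v‖).sum := by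
  -- With at most one candidate left there is nothing to ask: the identity serves, with no columns
  -- measured.
  have small : ∀ (k : ℕ) (M : Finset (Bits n → Bool)), M.card ≤ 1 →
      ∃ K : (Bits n → Bool) → E →ₗ[ℂ] E, (∀ v, ∑ r ∈ M, ‖K r v‖ ^ 2 ≤ ‖v‖ ^ 2) ∧
        ∀ r ∈ M, ∃ cs : List (Bits n), cs.length ≤ k ∧
          ∀ v, ‖v - K r v‖ ≤ (cs.map fun c => ‖P c (!r c) v‖).sum := by
    intro k M hM
    refine ⟨fun _ => LinearMap.id, fun v => ?_, fun r _ => ⟨[], by simp, fun v => by simp⟩⟩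
    have : (M.card : ℝ) ≤ 1 := by exact_mod_cast hM
    simpa using mul_le_of_le_one_left (sq_nonneg ‖v‖) this
  induction k with
  | zero =>
    intro M _ hk
    exact small 0 M (by simpa using hk)
  | succ k ih =>
    intro M hM hk
    by_cases h2 : 2 ≤ M.card
    swap
    · exact small _ M (by omega)
    obtain ⟨S, w, rfl⟩ := hM h2
    obtain ⟨c, hc⟩ := hs S w h2
    set M := fixColumns M' S w with hMdef
    have hcount := countEntry_add M c
    have hMpos : (0 : ℝ) < M.card := by exact_mod_cast (by omega : 0 < M.card)
    have hhalf : ∀ b, ((M.filter fun r => r c = b).card : ℝ) ≤ h * M.card := by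
      intro b
      unfold majorityFraction at hc
      rw [hcount, max_le_iff, div_le_iff₀ hMpos, div_le_iff₀ hMpos] at hc
      cases b
      · exact hc.2
      · exact hc.1
    have hsub : ∀ b, ∃ K : (Bits n → Bool) → E →ₗ[ℂ] E,
        (∀ v, ∑ r ∈ M.filter (fun r => r c = b), ‖K r v‖ ^ 2 ≤ ‖v‖ ^ 2) ∧
        ∀ r ∈ M.filter (fun r => r c = b), ∃ cs : List (Bits n), cs.length ≤ k ∧
          ∀ v, ‖v - K r v‖ ≤ (cs.map fun c => ‖P c (!r c) v‖).sum := by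
      intro b
      apply ih
      · intro hb
        obtain ⟨r₀, hr₀⟩ := Finset.card_pos.mp (by omega : 0 < (M.filter fun r => r c = b).card)
        -- Any surviving row `r₀` supplies the fixed values, both the old ones on `S` and the new
        -- one in `c`.
        refine ⟨insert c S, r₀, ?_⟩
        simp only [hMdef, fixColumns, Finset.mem_filter] at hr₀
        ext r
        simp only [hMdef, fixColumns, Finset.mem_filter, Finset.forall_mem_insert]
        constructor
        · rintro ⟨⟨hr, hS⟩, hb⟩
          exact ⟨hr, hb.trans hr₀.2.symm, fun c' hc' => (hS c' hc').trans (hr₀.1.2 c' hc').symm⟩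
        · rintro ⟨hr, hb, hS⟩
          exact ⟨⟨hr, fun c' hc' => (hS c' hc').trans (hr₀.1.2 c' hc')⟩, hb.trans hr₀.2⟩
      · calc ((M.filter fun r => r c = b).card : ℝ) * h ^ k ≤ h * M.card * h ^ k := by
              gcongr; exact hhalf b
          _ = M.card * h ^ (k + 1) := by ring
          _ ≤ 1 := hk
    choose K hK1 hK2 using hsub
    -- Project onto the answer that `r` gives in column `c`, then continue the search in that
    -- branch. Pythagoras for the two outcomes keeps the total weight at most that of `v`.
    refine ⟨fun r => K (r c) r ∘ₗ P c (r c), fun v => ?_, fun r hr => ?_⟩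
    · rw [← Finset.sum_filter_add_sum_filter_not M (fun r => r c = true), ← hnorm c v]
      simp only [Bool.not_eq_true]
      gcongr
      · refine le_trans (le_of_eq ?_) (hK1 true (P c true v))
        refine Finset.sum_congr rfl fun r hr => ?_
        simp [(Finset.mem_filter.mp hr).2]
      · refine le_trans (le_of_eq ?_) (hK1 false (P c false v))
        refine Finset.sum_congr rfl fun r hr => ?_
        simp [(Finset.mem_filter.mp hr).2]
    · have hr' : r ∈ M.filter (fun s => s c = r c) := Finset.mem_filter.mpr ⟨hr, rfl⟩
      obtain ⟨cs, hlen, hcs⟩ := hK2 (r c) r hr'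
      refine ⟨c :: cs, by simpa using hlen, fun v => ?_⟩
      have hcontr : ∀ u, ‖K (r c) r u‖ ≤ ‖u‖ := fun u =>
        le_of_sq_le_sq ((Finset.single_le_sum (f := fun r' => ‖K (r c) r' u‖ ^ 2)
          (fun _ _ => sq_nonneg _) hr').trans (hK1 (r c) u)) (norm_nonneg _)
      have hP : v - P c (r c) v = P c (!r c) v := by
        rw [sub_eq_iff_eq_add, add_comm]; exact (hsum c (r c) v).symm
      -- This split makes both errors refer to the original `v`, not to the state after the
      -- projection; contractivity of `K` removes it from the first term.
      have : v - (K (r c) r ∘ₗ P c (r c)) v = K (r c) r (P c (!r c) v) + (v - K (r c) r v) := by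
        rw [← hP, map_sub]; simp
      rw [this, List.map_cons, List.sum_cons]
      exact (norm_add_le _ _).trans (add_le_add (hcontr _) (hcs v))

/-- The dimension bound for identifying messages: if mixtures of vectors in the span of `e i`,
`i ∈ I`, are identified by a (sub-)measurement, then the success probabilities add up to at most
the cardinality of `I`. -/
theorem sum_success_le_card {E R A I : Type*} [NormedAddCommGroup E] [NormedSpace ℂ E]
    [Fintype A] [Fintype I] (s : Finset R) (K : R → E →ₗ[ℂ] E)
    (hK : ∀ v, ∑ r ∈ s, ‖K r v‖ ^ 2 ≤ ‖v‖ ^ 2) (e : I → E) (he : ∀ i, ‖e i‖ ^ 2 ≤ 1)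
    (a : R → A → I → ℂ) (ha : ∀ r ∈ s, ∑ k, ∑ i, ‖a r k i‖ ^ 2 ≤ 1) :
    ∑ r ∈ s, ∑ k, ‖K r (∑ i, a r k i • e i)‖ ^ 2 ≤ Fintype.card I := by
  have key : ∀ r ∈ s, ∑ k, ‖K r (∑ i, a r k i • e i)‖ ^ 2 ≤ ∑ i, ‖K r (e i)‖ ^ 2 := by
    intro r hr
    have hQ : 0 ≤ ∑ i, ‖K r (e i)‖ ^ 2 := Finset.sum_nonneg fun _ _ => sq_nonneg _
    calc ∑ k, ‖K r (∑ i, a r k i • e i)‖ ^ 2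
        ≤ ∑ k, (∑ i, ‖a r k i‖ ^ 2) * ∑ i, ‖K r (e i)‖ ^ 2 := by
          refine Finset.sum_le_sum fun k _ => ?_
          -- Cauchy–Schwarz separates the coefficients from the images of the spanning vectors, so
          -- the bound no longer depends on the individual mixture.
          refine le_trans ?_ (Finset.sum_mul_sq_le_sq_mul_sq _ _ _)
          gcongr
          rw [map_sum]
          refine (norm_sum_le _ _).trans (le_of_eq ?_)
          simp [norm_smul]
      _ = (∑ k, ∑ i, ‖a r k i‖ ^ 2) * ∑ i, ‖K r (e i)‖ ^ 2 := by rw [Finset.sum_mul]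
      _ ≤ _ := mul_le_of_le_one_left hQ (ha r hr)
  calc _ ≤ ∑ r ∈ s, ∑ i, ‖K r (e i)‖ ^ 2 := Finset.sum_le_sum key
    _ = ∑ i, ∑ r ∈ s, ‖K r (e i)‖ ^ 2 := Finset.sum_comm
    _ ≤ ∑ i : I, (1 : ℝ) := Finset.sum_le_sum fun i _ => (hK _).trans (he i)
    _ = Fintype.card I := by simp

/-! ### Error reduction by majority -/

/-- The majority of a string of bits. -/
def majorityBit {t : ℕ} (w : Bits t) : Bool :=
  decide ((Finset.univ.filter fun j => w j = false).card <
    (Finset.univ.filter fun j => w j = true).card)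

/-- The inequality is weak because a tie counts as `false`. -/
theorem card_filter_le_of_majorityBit {t : ℕ} {w : Bits t} {b : Bool}
    (hw : majorityBit w = !b) :
    (Finset.univ.filter fun j => w j = b).card ≤
      (Finset.univ.filter fun j => w j = !b).card := by
  cases b <;> simp [majorityBit] at hw ⊢ <;> omega

/-- The Chernoff bound for the majority of independent bits. -/
theorem sum_majorityBit_wrong_le {S : Type*} [Fintype S] {ε : ℝ} (hε0 : 0 < ε)
    (hε : ε < 1 / 2) (p : S → ℝ) (hp : ∀ s, 0 ≤ p s) (hp1 : ∑ s, p s = 1) (o : S → Bool)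
    (b : Bool) (hb : 1 - ε ≤ ∑ s, if o s = b then p s else 0) (t : ℕ) :
    ∑ s : Fin t → S, (if majorityBit (fun j => o (s j)) = !b then ∏ j, p (s j) else 0) ≤
      (2 * Real.sqrt (ε * (1 - ε))) ^ t := by
  have he : 0 < 1 - ε := by linarith
  -- The exponential tilt: a right bit gets weight 1/l and a wrong one l, so a wrong majority has
  -- total weight at least 1. This l balances the two terms: the mean weight of one bit at error
  -- exactly ε is (1-ε)/l + εl = 2√(ε(1-ε)), and it is no larger for a smaller error.
  set l : ℝ := Real.sqrt ((1 - ε) / ε) with hl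
  have hlpos : 0 < l := Real.sqrt_pos.mpr (by positivity)
  have hl2 : l ^ 2 = (1 - ε) / ε := Real.sq_sqrt (by positivity)
  have hl1 : 1 ≤ l := by
    apply Real.one_le_sqrt.mpr
    rw [le_div_iff₀ hε0]; linarith
  have hβ : Real.sqrt (ε * (1 - ε)) = ε * l := by
    rw [Real.sqrt_eq_iff_mul_self_eq (by positivity) (by positivity)]
    calc ε * (1 - ε) = ε ^ 2 * ((1 - ε) / ε) := by field_simp
      _ = ε * l * (ε * l) := by rw [← hl2]; ring
  have hinv : (1 - ε) * l⁻¹ = ε * l := by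
    have : 1 - ε = ε * l ^ 2 := by rw [hl2]; field_simp
    rw [this]; field_simp
  have hli : l⁻¹ ≤ 1 := inv_le_one_of_one_le₀ hl1
  have hbase : ∑ s, p s * (if o s = b then l⁻¹ else l) ≤ 2 * Real.sqrt (ε * (1 - ε)) := by
    set q := ∑ s, if o s = b then p s else 0
    have : ∑ s, p s * (if o s = b then l⁻¹ else l) = q * l⁻¹ + (1 - q) * l := by
      rw [← hp1, ← Finset.sum_sub_distrib, Finset.sum_mul, Finset.sum_mul,
        ← Finset.sum_add_distrib]
      refine Finset.sum_congr rfl fun s _ => ?_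
      split_ifs <;> ring
    rw [this, hβ]
    nlinarith [mul_nonneg (sub_nonneg.mpr hb) (sub_nonneg.mpr (hli.trans hl1))]
  calc ∑ s : Fin t → S, (if majorityBit (fun j => o (s j)) = !b then ∏ j, p (s j) else 0)
      ≤ ∑ s : Fin t → S, ∏ j, (p (s j) * (if o (s j) = b then l⁻¹ else l)) := by
        refine Finset.sum_le_sum fun s _ => ?_
        rw [Finset.prod_mul_distrib]
        have hpp : 0 ≤ ∏ j, p (s j) := Finset.prod_nonneg fun _ _ => hp _
        split_ifs with hm
        · refine le_mul_of_one_le_right hpp ?_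
          have hc := card_filter_le_of_majorityBit hm
          rw [Finset.prod_ite, Finset.prod_const, Finset.prod_const, inv_pow,
            ← div_eq_inv_mul, one_le_div (by positivity)]
          have : (Finset.univ.filter fun j => ¬ o (s j) = b) =
              Finset.univ.filter fun j => o (s j) = !b := by
            ext j; cases o (s j) <;> cases b <;> simp
          rw [this]
          exact pow_le_pow_right₀ hl1 hc
        · refine mul_nonneg hpp (Finset.prod_nonneg fun j _ => ?_)
          split_ifs <;> positivity
    _ = (∑ s, p s * (if o s = b then l⁻¹ else l)) ^ t := by rw [Fintype.sum_pow]
    _ ≤ _ := by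
        refine pow_le_pow_left₀ (Finset.sum_nonneg fun s _ => mul_nonneg (hp s) ?_) hbase t
        split_ifs <;> positivity

/-! ### Tensor powers and projections -/

section LinearAlgebra

variable {ι : Type*} [Fintype ι]

/-- The tensor power of a square matrix. -/
def tensorPower (t : ℕ) (A : Matrix ι ι ℂ) : Matrix (Fin t → ι) (Fin t → ι) ℂ :=
  Matrix.of fun s s' => ∏ j, A (s j) (s' j)

theorem sum_prod_apply {κ : Type*} [Fintype κ] {R : Type*} [CommSemiring R] {t : ℕ}
    (f : Fin t → κ → R) : ∑ s : Fin t → κ, ∏ j, f j (s j) = ∏ j, ∑ i, f j i := by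
  rw [Finset.prod_univ_sum, Fintype.piFinset_univ]

theorem tensorPower_mulVec (t : ℕ) (A : Matrix ι ι ℂ) (v : Fin t → ι → ℂ) (s : Fin t → ι) :
    (tensorPower t A).mulVec (fun s => ∏ j, v j (s j)) s = ∏ j, A.mulVec (v j) (s j) := by
  simp only [Matrix.mulVec, dotProduct, tensorPower, Matrix.of_apply, ← Finset.prod_mul_distrib]
  exact sum_prod_apply (fun j u => A (s j) u * v j u)

variable [DecidableEq ι]

theorem sum_norm_sq_mulVec {A : Matrix ι ι ℂ} (hA : A.conjTranspose * A = 1) (v : ι → ℂ) :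
    ∑ i, ‖A.mulVec v i‖ ^ 2 = ∑ i, ‖v i‖ ^ 2 := by
  have h : ∀ w : ι → ℂ, ((∑ i, ‖w i‖ ^ 2 : ℝ) : ℂ) = star w ⬝ᵥ w := by
    intro w
    simp [dotProduct, Complex.conj_mul']
  have : ((∑ i, ‖A.mulVec v i‖ ^ 2 : ℝ) : ℂ) = ((∑ i, ‖v i‖ ^ 2 : ℝ) : ℂ) := by
    rw [h, h, Matrix.star_mulVec, ← Matrix.dotProduct_mulVec, Matrix.mulVec_mulVec, hA,
      Matrix.one_mulVec]
  exact_mod_cast this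

theorem tensorPower_conjTranspose_mul_self {A : Matrix ι ι ℂ} (hA : A.conjTranspose * A = 1)
    (t : ℕ) : (tensorPower t A).conjTranspose * tensorPower t A = 1 := by
  ext s s'
  have : ∀ i i', ∑ u, star (A u i) * A u i' = (1 : Matrix ι ι ℂ) i i' := fun i i' => by
    rw [← hA]; rfl
  simp only [Matrix.mul_apply, Matrix.conjTranspose_apply, tensorPower, Matrix.of_apply,
    star_prod, ← Finset.prod_mul_distrib]
  rw [sum_prod_apply (fun j u => star (A u (s j)) * A u (s' j))]
  rw [Finset.prod_congr rfl fun j _ => this (s j) (s' j)]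
  by_cases h : s = s'
  · subst h
    simp
  · obtain ⟨j, hj⟩ := Function.ne_iff.mp h
    rw [Matrix.one_apply_ne h]
    exact Finset.prod_eq_zero (Finset.mem_univ j) (Matrix.one_apply_ne hj)

/-- Applying `A`, projecting onto the basis states with label `b`, and undoing `A`. -/
noncomputable def labelProjection (A : Matrix ι ι ℂ) (g : ι → Bool) (b : Bool) :
    EuclideanSpace ℂ ι →ₗ[ℂ] EuclideanSpace ℂ ι :=
  Matrix.toLpLin 2 2 (A.conjTranspose * Matrix.diagonal (fun i => if g i = b then 1 else 0) * A)

theorem labelProjection_add {A : Matrix ι ι ℂ} (hA : A.conjTranspose * A = 1) (g : ι → Bool)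
    (b : Bool) (v : EuclideanSpace ℂ ι) :
    labelProjection A g b v + labelProjection A g (!b) v = v := by
  have : (Matrix.diagonal (fun i => if g i = b then (1 : ℂ) else 0)) +
      Matrix.diagonal (fun i => if g i = !b then (1 : ℂ) else 0) = 1 := by
    rw [Matrix.diagonal_add, ← Matrix.diagonal_one]
    congr 1
    ext i
    cases g i <;> cases b <;> simp
  rw [← LinearMap.add_apply, labelProjection, labelProjection, ← map_add, ← add_mul, ← mul_add,
    this, mul_one, hA]
  simp

/-- Undoing `A` preserves the norm, so this is the probability of outcome `b` after applying `A`. -/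
theorem norm_sq_labelProjection {A : Matrix ι ι ℂ} (hA : A.conjTranspose * A = 1) (g : ι → Bool)
    (b : Bool) (v : EuclideanSpace ℂ ι) :
    ‖labelProjection A g b v‖ ^ 2 = ∑ i, if g i = b then ‖A.mulVec v.ofLp i‖ ^ 2 else 0 := by
  have hA' : A.conjTranspose.conjTranspose * A.conjTranspose = 1 := by
    rw [Matrix.conjTranspose_conjTranspose]
    exact mul_eq_one_comm.mp hA
  rw [EuclideanSpace.norm_sq_eq, labelProjection, Matrix.toLpLin_apply]
  simp only [← Matrix.mulVec_mulVec]
  rw [sum_norm_sq_mulVec hA']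
  refine Finset.sum_congr rfl fun i _ => ?_
  rw [Matrix.mulVec_diagonal]
  split_ifs <;> simp

theorem norm_sq_labelProjection_add {A : Matrix ι ι ℂ} (hA : A.conjTranspose * A = 1)
    (g : ι → Bool) (v : EuclideanSpace ℂ ι) :
    ‖labelProjection A g true v‖ ^ 2 + ‖labelProjection A g false v‖ ^ 2 = ‖v‖ ^ 2 := by
  rw [norm_sq_labelProjection hA, norm_sq_labelProjection hA, EuclideanSpace.norm_sq_eq,
    ← sum_norm_sq_mulVec hA, ← Finset.sum_add_distrib]
  refine Finset.sum_congr rfl fun i _ => ?_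
  cases g i <;> simp

end LinearAlgebra

theorem unitary_conjTranspose_mul {ι : Type*} [Fintype ι] [DecidableEq ι]
    (U : Matrix.unitaryGroup ι ℂ) :
    (U : Matrix ι ι ℂ).conjTranspose * (U : Matrix ι ι ℂ) = 1 :=
  Matrix.mem_unitaryGroup_iff'.mp U.2

/-! ### Parallel runs of a protocol -/

namespace OneWayProtocol

variable {X Y : Type} {C : ℕ}

theorem sum_norm_sq_aliceState (P : OneWayProtocol X Y C) (x : X) :
    ∑ s, ‖P.aliceState x s‖ ^ 2 = 1 := by
  rw [aliceState, sum_norm_sq_mulVec (unitary_conjTranspose_mul _)]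
  rw [Finset.sum_eq_single (zeroBits P.keep, zeroBits C)]
  · simp
  · intro s _ hs; simp [Pi.single_eq_of_ne hs]
  · simp

/-- Bob never touches the kept qubits, so their basis state `a` is a mere index: Bob sees a mixture
of unnormalized vectors, one for each `a`. -/
theorem finalState_apply (P : OneWayProtocol X Y C) (x : X) (y : Y) (a : Bits P.keep)
    (z : Bits C × Bits P.work) :
    P.finalState x y (a, z) =
      (P.bob y : Matrix _ _ ℂ).mulVec (fun z => P.sentState x (a, z)) z := by
  simp only [finalState, Matrix.mulVec, dotProduct]
  rw [Fintype.sum_prod_type, Finset.sum_eq_single a]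
  · simp
  · intro a' _ ha'
    simp [Matrix.one_apply_ne ha'.symm]
  · simp

theorem sum_norm_sq_sentState (P : OneWayProtocol X Y C) (x : X) :
    ∑ s, ‖P.sentState x s‖ ^ 2 = 1 := by
  rw [← P.sum_norm_sq_aliceState x, Fintype.sum_prod_type, Fintype.sum_prod_type]
  refine Finset.sum_congr rfl fun a _ => ?_
  rw [Fintype.sum_prod_type]
  refine Finset.sum_congr rfl fun z _ => ?_
  rw [Finset.sum_eq_single (zeroBits P.work)]
  · simp [sentState]
  · intro w _ hw; simp [sentState, Pi.single_eq_of_ne hw]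
  · simp

theorem sum_norm_sq_finalState (P : OneWayProtocol X Y C) (x : X) (y : Y) :
    ∑ s, ‖P.finalState x y s‖ ^ 2 = 1 := by
  rw [← P.sum_norm_sq_sentState x, Fintype.sum_prod_type, Fintype.sum_prod_type]
  refine Finset.sum_congr rfl fun a _ => ?_
  simp only [finalState_apply]
  exact sum_norm_sq_mulVec (unitary_conjTranspose_mul _) _

/-- The measured qubit of Bob as a function of his basis states. -/
def bobBit (P : OneWayProtocol X Y C) (z : Bits C × Bits P.work) : Bool :=
  Sum.elim z.1 z.2 P.out

/-- The state of Bob's qubits in `t` parallel runs, when Alice's qubits that she keeps are in the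
basis state `a`. -/
noncomputable def copies (P : OneWayProtocol X Y C) (t : ℕ) (x : X) (a : Fin t → Bits P.keep) :
    EuclideanSpace ℂ (Fin t → Bits C × Bits P.work) :=
  WithLp.toLp 2 fun s => ∏ j, P.sentState x (a j, s j)

/-- The projection that measures whether the majority of the outputs of `t` parallel runs
is `b`. -/
noncomputable def majorityProjection (P : OneWayProtocol X Y C) (t : ℕ) (y : Y) (b : Bool) :
    EuclideanSpace ℂ (Fin t → Bits C × Bits P.work) →ₗ[ℂ]
      EuclideanSpace ℂ (Fin t → Bits C × Bits P.work) :=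
  labelProjection (tensorPower t (P.bob y : Matrix _ _ ℂ))
    (fun s => majorityBit fun j => P.bobBit (s j)) b

theorem majorityProjection_add (P : OneWayProtocol X Y C) (t : ℕ) (y : Y) (b : Bool)
    (v : EuclideanSpace ℂ (Fin t → Bits C × Bits P.work)) :
    P.majorityProjection t y b v + P.majorityProjection t y (!b) v = v :=
  labelProjection_add
    (tensorPower_conjTranspose_mul_self (unitary_conjTranspose_mul (P.bob y)) t) _ b v

theorem norm_sq_majorityProjection_add (P : OneWayProtocol X Y C) (t : ℕ) (y : Y)
    (v : EuclideanSpace ℂ (Fin t → Bits C × Bits P.work)) :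
    ‖P.majorityProjection t y true v‖ ^ 2 + ‖P.majorityProjection t y false v‖ ^ 2 = ‖v‖ ^ 2 :=
  norm_sq_labelProjection_add
    (tensorPower_conjTranspose_mul_self (unitary_conjTranspose_mul (P.bob y)) t) _ v

theorem sum_prod_pair {t : ℕ} {A Z : Type*} [Fintype A] [Fintype Z] (F : (Fin t → A × Z) → ℝ) :
    ∑ a : Fin t → A, ∑ s : Fin t → Z, F (fun j => (a j, s j)) = ∑ u, F u := by
  rw [← Fintype.sum_prod_type' (f := fun (a : Fin t → A) (s : Fin t → Z) => F fun j => (a j, s j))]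
  exact (Equiv.arrowProdEquivProdArrow (Fin t) (fun _ => A) (fun _ => Z)).symm.sum_comp F

/-- Amplitudes of parallel runs multiply, so the outputs are independent samples and the classical
Chernoff bound becomes applicable. -/
theorem sum_norm_sq_majorityProjection (P : OneWayProtocol X Y C) (t : ℕ) (x : X) (y : Y)
    (b : Bool) :
    ∑ a, ‖P.majorityProjection t y b (P.copies t x a)‖ ^ 2 =
      ∑ u : Fin t → Bits P.keep × (Bits C × Bits P.work),
        if majorityBit (fun j => P.outBit (u j)) = b
        then ∏ j, ‖P.finalState x y (u j)‖ ^ 2 else 0 := by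
  rw [← sum_prod_pair]
  refine Finset.sum_congr rfl fun a _ => ?_
  rw [majorityProjection, norm_sq_labelProjection
    (tensorPower_conjTranspose_mul_self (unitary_conjTranspose_mul _) t)]
  refine Finset.sum_congr rfl fun s _ => ?_
  have : (tensorPower t (P.bob y : Matrix _ _ ℂ)).mulVec (P.copies t x a).ofLp s =
      ∏ j, P.finalState x y (a j, s j) := by
    simp only [finalState_apply]
    exact tensorPower_mulVec t _ (fun j z => P.sentState x (a j, z)) s
  rw [this, norm_prod, Finset.prod_pow]
  rfl

theorem sum_norm_sq_copies (P : OneWayProtocol X Y C) (t : ℕ) (x : X) :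
    ∑ a, ‖P.copies t x a‖ ^ 2 = 1 := by
  calc ∑ a, ‖P.copies t x a‖ ^ 2
      = ∑ a : Fin t → Bits P.keep, ∑ s : Fin t → Bits C × Bits P.work,
          ∏ j, ‖P.sentState x (a j, s j)‖ ^ 2 := by
        refine Finset.sum_congr rfl fun a _ => ?_
        rw [EuclideanSpace.norm_sq_eq]
        refine Finset.sum_congr rfl fun s _ => ?_
        rw [copies, norm_prod, Finset.prod_pow]
    _ = ∑ u : Fin t → Bits P.keep × (Bits C × Bits P.work), ∏ j, ‖P.sentState x (u j)‖ ^ 2 :=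
        sum_prod_pair fun u => ∏ j, ‖P.sentState x (u j)‖ ^ 2
    _ = 1 := by rw [← Fintype.sum_pow (fun s => ‖P.sentState x s‖ ^ 2), sum_norm_sq_sentState, one_pow]

/-- The basis states that `t` messages can be in. -/
noncomputable def messageBasis (P : OneWayProtocol X Y C) (t : ℕ) (i : Fin t → Bits C) :
    EuclideanSpace ℂ (Fin t → Bits C × Bits P.work) :=
  EuclideanSpace.single (fun j => (i j, zeroBits P.work)) 1

theorem norm_sq_messageBasis (P : OneWayProtocol X Y C) (t : ℕ) (i : Fin t → Bits C) :
    ‖P.messageBasis t i‖ ^ 2 = 1 := by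
  simp [messageBasis]

/-- Bob's work qubits start in the zero state, so only the 2^(Ct) message strings span; this makes
the dimension bound independent of the workspace. -/
theorem copies_eq_sum (P : OneWayProtocol X Y C) (t : ℕ) (x : X) (a : Fin t → Bits P.keep) :
    P.copies t x a =
      ∑ i : Fin t → Bits C, (∏ j, P.aliceState x (a j, i j)) • P.messageBasis t i := by
  ext s
  simp only [WithLp.ofLp_sum, Finset.sum_apply, WithLp.ofLp_smul, Pi.smul_apply, smul_eq_mul,
    messageBasis, copies, PiLp.single_apply]
  have : ∀ i : Fin t → Bits C, (if s = fun j => (i j, zeroBits P.work) then (1 : ℂ) else 0) =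
      ∏ j, (if (s j).1 = i j then 1 else 0) * (if (s j).2 = zeroBits P.work then 1 else 0) := by
    intro i
    simp only [← ite_and, mul_ite, mul_one, mul_zero, Finset.prod_ite_zero, funext_iff,
      Prod.ext_iff, Finset.prod_const_one, Finset.mem_univ, true_implies]
    simp only [and_comm]
  simp only [this, ← Finset.prod_mul_distrib]
  rw [sum_prod_apply (fun j i => P.aliceState x (a j, i) *
    ((if (s j).1 = i then 1 else 0) * (if (s j).2 = zeroBits P.work then 1 else 0)))]
  refine Finset.prod_congr rfl fun j _ => ?_
  simp [sentState, Pi.single_apply]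

theorem sum_norm_sq_prod_aliceState (P : OneWayProtocol X Y C) (t : ℕ) (x : X) :
    ∑ a : Fin t → Bits P.keep, ∑ i : Fin t → Bits C,
      ‖∏ j, P.aliceState x (a j, i j)‖ ^ 2 = 1 := by
  simp only [norm_prod, ← Finset.prod_pow]
  rw [sum_prod_pair fun u => ∏ j, ‖P.aliceState x (u j)‖ ^ 2,
    ← Fintype.sum_pow (fun s => ‖P.aliceState x s‖ ^ 2), sum_norm_sq_aliceState, one_pow]

theorem sum_norm_sq_wrong_le {P : OneWayProtocol X Y C} {ε : ℝ} {f : X → Y → Bool}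
    (hP : P.Computes ε f) (hε0 : 0 < ε) (hε : ε < 1 / 2) (t : ℕ) (x : X) (y : Y) :
    ∑ a, ‖P.majorityProjection t y (!f x y) (P.copies t x a)‖ ^ 2 ≤
      (2 * Real.sqrt (ε * (1 - ε))) ^ t := by
  rw [sum_norm_sq_majorityProjection]
  exact sum_majorityBit_wrong_le hε0 hε (fun s => ‖P.finalState x y s‖ ^ 2)
    (fun _ => sq_nonneg _) (P.sum_norm_sq_finalState x y) P.outBit (f x y) (hP x y) t

end OneWayProtocol

/-! ### From small disturbance to a bound on the number of rows -/

/-- The weighted inequality (a+b)² ≤ (1+1/4)a² + (1+4)b². -/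
theorem norm_sq_le_of_norm_sub {E : Type*} [NormedAddCommGroup E] (u v : E) :
    ‖u‖ ^ 2 ≤ 5 / 4 * ‖v‖ ^ 2 + 5 * ‖u - v‖ ^ 2 := by
  have h : ‖u‖ ≤ ‖v‖ + ‖u - v‖ := norm_le_norm_add_norm_sub' u v
  nlinarith [sq_nonneg (‖v‖ - 4 * ‖u - v‖), norm_nonneg u, norm_nonneg v, norm_nonneg (u - v)]

theorem list_sum_sq_le {α : Type*} (g : α → ℝ) (l : List α) :
    (l.map g).sum ^ 2 ≤ l.length * (l.map fun a => g a ^ 2).sum := by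
  rw [← Fin.sum_univ_fun_getElem, ← Fin.sum_univ_fun_getElem]
  simpa using sq_sum_le_card_mul_sum_sq (s := Finset.univ) (f := fun i : Fin l.length => g l[i])

/-- An operator that differs from the identity by at most `N` wrong outcomes keeps at least half of
the weight of the message. -/
theorem OneWayProtocol.half_le_success {X Y : Type} {C : ℕ} {P : OneWayProtocol X Y C} {ε : ℝ}
    {f : X → Y → Bool} (hP : P.Computes ε f) (hε0 : 0 < ε) (hε : ε < 1 / 2) {N t : ℕ}
    (ht : (N : ℝ) ^ 2 * (2 * Real.sqrt (ε * (1 - ε))) ^ t ≤ 1 / 25) (x : X)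
    (K : EuclideanSpace ℂ (Fin t → Bits C × Bits P.work) →ₗ[ℂ]
      EuclideanSpace ℂ (Fin t → Bits C × Bits P.work))
    (cs : List Y) (hlen : cs.length ≤ N)
    (hcs : ∀ v, ‖v - K v‖ ≤ (cs.map fun c => ‖P.majorityProjection t c (!f x c) v‖).sum) :
    (1 / 2 : ℝ) ≤ ∑ a, ‖K (P.copies t x a)‖ ^ 2 := by
  set β := (2 * Real.sqrt (ε * (1 - ε))) ^ t with hβ
  have hβ0 : 0 ≤ β := by positivity
  have hlen' : (cs.length : ℝ) ≤ N := by exact_mod_cast hlen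
  have hdist : ∑ a, ‖P.copies t x a - K (P.copies t x a)‖ ^ 2 ≤ 1 / 25 := by
    calc ∑ a, ‖P.copies t x a - K (P.copies t x a)‖ ^ 2
        ≤ ∑ a, cs.length * ∑ i : Fin cs.length,
            ‖P.majorityProjection t cs[i] (!f x cs[i]) (P.copies t x a)‖ ^ 2 := by
          refine Finset.sum_le_sum fun a _ => ?_
          refine (pow_le_pow_left₀ (norm_nonneg _) (hcs _) 2).trans ?_
          refine (list_sum_sq_le _ _).trans (le_of_eq ?_)
          rw [← Fin.sum_univ_fun_getElem]
          rfl
      _ = cs.length * ∑ i : Fin cs.length, ∑ a,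
            ‖P.majorityProjection t cs[i] (!f x cs[i]) (P.copies t x a)‖ ^ 2 := by
          rw [← Finset.mul_sum, Finset.sum_comm]
      _ ≤ cs.length * ∑ i : Fin cs.length, β := by
          refine mul_le_mul_of_nonneg_left (Finset.sum_le_sum fun i _ => ?_) (Nat.cast_nonneg _)
          exact OneWayProtocol.sum_norm_sq_wrong_le hP hε0 hε t _ _
      _ = (cs.length : ℝ) ^ 2 * β := by
          rw [Finset.sum_const, Finset.card_univ, Fintype.card_fin, nsmul_eq_mul]; ring
      _ ≤ (N : ℝ) ^ 2 * β := by gcongr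
      _ ≤ _ := ht
  have htotal : ∑ a, ‖P.copies t x a‖ ^ 2 ≤
      5 / 4 * ∑ a, ‖K (P.copies t x a)‖ ^ 2 +
      5 * ∑ a, ‖P.copies t x a - K (P.copies t x a)‖ ^ 2 := by
    rw [Finset.mul_sum, Finset.mul_sum, ← Finset.sum_add_distrib]
    exact Finset.sum_le_sum fun a _ => norm_sq_le_of_norm_sub _ _
  rw [P.sum_norm_sq_copies] at htotal
  -- With S the success weight, 1 ≤ (5/4)S + 5/25 gives S ≥ 16/25.
  linarith

/-- The rows that are identified from `t` messages of `C` qubits have total success probability at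
most `2 ^ (C * t)`. -/
theorem OneWayProtocol.sum_success_le {X Y R : Type} {C : ℕ} (P : OneWayProtocol X Y C) (t : ℕ)
    (s : Finset R) (K : R → EuclideanSpace ℂ (Fin t → Bits C × Bits P.work) →ₗ[ℂ]
      EuclideanSpace ℂ (Fin t → Bits C × Bits P.work))
    (hK : ∀ v, ∑ r ∈ s, ‖K r v‖ ^ 2 ≤ ‖v‖ ^ 2) (x : R → X) :
    ∑ r ∈ s, ∑ a, ‖K r (P.copies t (x r) a)‖ ^ 2 ≤ 2 ^ (C * t) := by
  have h1 := fun r => (P.sum_norm_sq_prod_aliceState t (x r)).le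
  have h2 := sum_success_le_card (A := Fin t → Bits P.keep) s K hK (P.messageBasis t)
    (fun i => (P.norm_sq_messageBasis t i).le)
    (fun r a i => ∏ j, P.aliceState (x r) (a j, i j))
  have h3 := h2 (fun r _ => h1 r)
  have hcard : (Fintype.card (Fin t → Bits C) : ℝ) = 2 ^ (C * t) := by
    rw [Fintype.card_fun, Fintype.card_fun]
    simp only [Fintype.card_fin, Fintype.card_bool, pow_mul]
    push_cast
    rfl
  rw [hcard] at h3
  refine le_trans (le_of_eq ?_) h3
  refine Finset.sum_congr rfl fun r _ => Finset.sum_congr rfl fun a _ => ?_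
  rw [P.copies_eq_sum]

/-- A protocol whose error is small enough after `t` parallel runs identifies the rows of `M'`
by a binary search of depth `N`, so that the messages need enough dimensions. -/
theorem card_le_of_computes {m n C : ℕ} {f : Bits m → Bits n → Bool}
    {P : OneWayProtocol (Bits m) (Bits n) C} {ε : ℝ} (hP : P.Computes ε f) (hε0 : 0 < ε)
    (hε : ε < 1 / 2) {M' : Finset (Bits n → Bool)} (hM' : M' ⊆ commRows f) {h : ℝ} (h0 : 0 ≤ h)
    (hs : SplitsWithin M' h) {N t : ℕ} (hN : M'.card * h ^ N ≤ 1)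
    (ht : (N : ℝ) ^ 2 * (2 * Real.sqrt (ε * (1 - ε))) ^ t ≤ 1 / 25) :
    (M'.card : ℝ) ≤ 2 * 2 ^ (C * t) := by
  obtain ⟨K, hK1, hK2⟩ := exists_rowOperators (P.majorityProjection t)
    (P.majorityProjection_add t) (P.norm_sq_majorityProjection_add t) h0 hs N M'
    (fun _ => ⟨∅, fun _ => false, by simp [fixColumns]⟩) hN
  have hrow : ∀ r : Bits n → Bool, ∃ x, r ∈ M' → f x = r := by
    intro r
    by_cases hr : r ∈ M'
    · obtain ⟨x, _, hx⟩ := Finset.mem_image.mp (hM' hr)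
      exact ⟨x, fun _ => hx⟩
    · exact ⟨zeroBits m, fun h => absurd h hr⟩
  choose x hx using hrow
  have hlower : ∑ r ∈ M', (1 / 2 : ℝ) ≤ ∑ r ∈ M', ∑ a, ‖K r (P.copies t (x r) a)‖ ^ 2 := by
    refine Finset.sum_le_sum fun r hr => ?_
    obtain ⟨cs, hlen, hcs⟩ := hK2 r hr
    exact OneWayProtocol.half_le_success hP hε0 hε ht (x r) (K r) cs hlen (by rwa [hx r hr])
  have hupper := P.sum_success_le t M' K hK1 x
  rw [Finset.sum_const, nsmul_eq_mul] at hlower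
  linarith

/-! ### The trivial protocol -/

/-- Sending the whole input computes every function without error. -/
theorem exists_computes {m n : ℕ} (f : Bits m → Bits n → Bool) {ε : ℝ} (hε : 0 ≤ ε) :
    ∃ P : OneWayProtocol (Bits m) (Bits n) m, P.Computes ε f := by
  have hperm : ∀ {ι : Type} [Fintype ι] [DecidableEq ι] (σ : Equiv.Perm ι),
      σ.permMatrix ℂ ∈ Matrix.unitaryGroup ι ℂ := by
    intro ι _ _ σ
    rw [Matrix.mem_unitaryGroup_iff, Matrix.star_eq_conjTranspose,
      Matrix.conjTranspose_permMatrix, ← Matrix.permMatrix_mul]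
    simp
  -- Both unitaries permute basis states: Alice XORs `x` into the message, and Bob XORs the function
  -- value into a work qubit. XOR is an involution, hence a permutation.
  let A : Bits m → Equiv.Perm (Bits 0 × Bits m) := fun x =>
    Function.Involutive.toPerm (fun s => (s.1, fun j => xor (x j) (s.2 j)))
      (fun s => by simp)
  let B : Bits n → Equiv.Perm (Bits m × Bits 1) := fun y =>
    Function.Involutive.toPerm (fun s => (s.1, fun j => xor (f s.1 y) (s.2 j)))
      (fun s => by simp)
  let P : OneWayProtocol (Bits m) (Bits n) m :=
    { keep := 0
      work := 1
      alice := fun x => ⟨_, hperm (A x)⟩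
      bob := fun y => ⟨_, hperm (B y)⟩
      out := Sum.inr 0 }
  refine ⟨P, fun x y => ?_⟩
  have hstate : ∀ s, P.finalState x y s =
      if s = (zeroBits 0, (x, fun _ => f x y)) then 1 else 0 := by
    rintro ⟨a, z⟩
    rw [OneWayProtocol.finalState_apply]
    change ((B y).permMatrix ℂ).mulVec _ z = _
    rw [Matrix.permMatrix_mulVec]
    change ((A x).permMatrix ℂ).mulVec _ (a, z.1) * _ = _
    rw [Matrix.permMatrix_mulVec]
    change (Pi.single (zeroBits 0, zeroBits m) 1 : Bits 0 × Bits m → ℂ)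
      (a, fun j => xor (x j) (z.1 j)) *
      (Pi.single (zeroBits 1) 1 : Bits 1 → ℂ) (fun j => xor (f z.1 y) (z.2 j)) = _
    obtain ⟨z, w⟩ := z
    have h1 : ∀ {k : ℕ} (u v : Bits k), (fun j => xor (u j) (v j)) = zeroBits k ↔ v = u := by
      intro k u v
      simp only [funext_iff, zeroBits]
      refine forall_congr' fun j => ?_
      cases u j <;> cases v j <;> simp
    have h2 : (fun j => xor (f z y) (w j)) = zeroBits 1 ↔ w = fun _ => f z y := h1 _ w
    have ha : a = zeroBits 0 := Subsingleton.elim _ _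
    rw [Pi.single_apply, Pi.single_apply]
    simp only [Prod.mk.injEq, h1 x z, ha, true_and]
    by_cases hz : z = x
    · subst hz
      simpa using if_congr h2 rfl rfl
    · simp [hz]
  have hprob : P.prob x y (f x y) = 1 := by
    rw [OneWayProtocol.prob, Finset.sum_eq_single (zeroBits 0, (x, fun _ => f x y))]
    · rw [hstate]
      simp [OneWayProtocol.outBit, P]
    · intro s _ hs
      rw [hstate, if_neg hs]
      simp
    · simp
  linarith

/-! ### The range of the balance and the choice of constants -/

theorem half_le_of_splitsWithin {n : ℕ} {M' : Finset (Bits n → Bool)} (hM : 2 ≤ M'.card) {h : ℝ}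
    (hs : SplitsWithin M' h) : 1 / 2 ≤ h := by
  obtain ⟨c, hc⟩ := hs ∅ (fun _ => false) (by simpa [fixColumns] using hM)
  have hM' : fixColumns M' ∅ (fun _ => false) = M' := by simp [fixColumns]
  have hpos : (0 : ℝ) < M'.card := by exact_mod_cast (by omega : 0 < M'.card)
  have hadd := countEntry_add M' c
  unfold majorityFraction at hc
  rw [hM', hadd, max_le_iff, div_le_iff₀ hpos, div_le_iff₀ hpos] at hc
  nlinarith

/-- Two different rows differ in some column, where both values occur; the majority then misses at
least one row. -/
theorem exists_splitsWithin_lt_one {n : ℕ} {M' : Finset (Bits n → Bool)} (hM : 2 ≤ M'.card) :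
    ∃ h < 1, SplitsWithin M' h := by
  have hpos : (0 : ℝ) < M'.card := by exact_mod_cast (by omega : 0 < M'.card)
  refine ⟨1 - 1 / M'.card, sub_lt_self _ (by positivity), fun S v h2 => ?_⟩
  obtain ⟨r₁, h₁, r₂, h₂, hne⟩ := Finset.one_lt_card.mp (show 1 < (fixColumns M' S v).card from h2)
  obtain ⟨c, hc⟩ := Function.ne_iff.mp hne
  refine ⟨c, ?_⟩
  set M := fixColumns M' S v with hMdef
  have hsub : M.card ≤ M'.card := Finset.card_le_card (Finset.filter_subset _ _)
  have hMpos : (0 : ℝ) < M.card := by exact_mod_cast (by omega : 0 < M.card)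
  have hone : ∀ b, (1 : ℝ) ≤ countEntry M c b := by
    intro b
    have : 0 < countEntry M c b := by
      refine Finset.card_pos.mpr ?_
      by_cases hb : r₁ c = b
      · exact ⟨r₁, Finset.mem_filter.mpr ⟨h₁, hb⟩⟩
      · refine ⟨r₂, Finset.mem_filter.mpr ⟨h₂, ?_⟩⟩
        revert hc hb
        cases r₁ c <;> cases r₂ c <;> cases b <;> simp
    exact_mod_cast this
  have hadd := countEntry_add M c
  have hle : 1 - 1 / (M.card : ℝ) ≤ 1 - 1 / M'.card := by
    have : (M.card : ℝ) ≤ M'.card := by exact_mod_cast hsub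
    gcongr
  refine le_trans ?_ hle
  have hq : 1 - 1 / (M.card : ℝ) = (M.card - 1) / M.card := by field_simp
  unfold majorityFraction
  rw [hadd, hq, max_le_iff]
  constructor
  · gcongr; linarith [hone false]
  · gcongr; linarith [hone true]

theorem splitBalance_lt_one {n : ℕ} {M' : Finset (Bits n → Bool)} (hM : 2 ≤ M'.card) :
    splitBalance M' < 1 := by
  obtain ⟨h, h1, hs⟩ := exists_splitsWithin_lt_one hM
  exact ((splitBalance_isLeast M' hM).2 hs).trans_lt h1

/-- The depth of the search is at least `log₂ 3`. -/
theorem logb_three_le_logb_splitBalance {n : ℕ} {M' : Finset (Bits n → Bool)}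
    (hM : 3 ≤ M'.card) :
    Real.logb 2 3 ≤ Real.logb (1 / splitBalance M') M'.card := by
  have hhalf := half_le_of_splitsWithin (by omega) (splitBalance_isLeast M' (by omega)).1
  have hlt := splitBalance_lt_one (M' := M') (by omega)
  set h := splitBalance M'
  have hb1 : 1 < 1 / h := by rw [lt_div_iff₀ (by linarith)]; linarith
  have hb2 : 1 / h ≤ 2 := by rw [div_le_iff₀ (by linarith)]; linarith
  have hR : (3 : ℝ) ≤ M'.card := by exact_mod_cast hM
  rw [Real.logb, Real.logb]
  have hlog := Real.log_pos hb1
  have : 0 < Real.log 3 := Real.log_pos (by norm_num)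
  gcongr

theorem card_mul_pow_ceil_le_one {h R : ℝ} (h0 : 0 < h) (h1 : h < 1) (hR : 1 ≤ R) :
    R * h ^ ⌈Real.logb (1 / h) R⌉₊ ≤ 1 := by
  have hb1 : 1 < 1 / h := by rw [lt_div_iff₀ h0]; linarith
  have : R ≤ (1 / h) ^ ⌈Real.logb (1 / h) R⌉₊ := by
    rw [← Real.rpow_natCast, ← Real.logb_le_iff_le_rpow hb1 (by linarith)]
    exact Nat.le_ceil _
  rw [div_pow, one_pow, le_div_iff₀ (by positivity)] at this
  exact this

/-- Logarithmically many parallel runs reduce the error below the inverse square of the depth of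
the search. -/
theorem exists_repetitions {β : ℝ} (hβ0 : 0 < β) (hβ1 : β < 1) :
    ∃ A : ℝ, 0 < A ∧ ∀ k : ℝ, Real.logb 2 3 ≤ k → ∃ t : ℕ,
      (⌈k⌉₊ : ℝ) ^ 2 * β ^ t ≤ 1 / 25 ∧ (t : ℝ) ≤ A * Real.logb 2 k := by
  -- From 2³ ≤ 3². It keeps log₂ k above the positive constant `l`, which lets additive constants be
  -- absorbed into a multiple of log₂ k.
  have h32 : (3 / 2 : ℝ) ≤ Real.logb 2 3 := by
    have h9 : Real.logb 2 ((2 : ℝ) ^ 3) ≤ Real.logb 2 ((3 : ℝ) ^ 2) :=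
      Real.logb_le_logb_of_le (by norm_num) (by norm_num) (by norm_num)
    rw [Real.logb_pow, Real.logb_pow, Real.logb_self_eq_one (by norm_num)] at h9
    norm_num at h9
    linarith
  set B := Real.log β⁻¹ with hB
  have hBpos : 0 < B := Real.log_pos (one_lt_inv_iff₀.mpr ⟨hβ0, hβ1⟩)
  set l := Real.logb 2 (3 / 2) with hl
  have hlpos : 0 < l := Real.logb_pos (by norm_num) (by norm_num)
  refine ⟨(Real.log 100 / B + 1) / l + 2 * Real.log 2 / B, by positivity, fun k hk => ?_⟩
  have hk32 : 3 / 2 ≤ k := h32.trans hk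
  -- Chosen so that β^t ≤ 1/(100k²); with ⌈k⌉ ≤ 2k the product is at most 4/100 = 1/25.
  refine ⟨⌈Real.log (100 * k ^ 2) / B⌉₊, ?_, ?_⟩
  · have hceil : (⌈k⌉₊ : ℝ) ≤ 2 * k := by
      have := Nat.ceil_lt_add_one (show 0 ≤ k by linarith)
      linarith
    have hpow : 100 * k ^ 2 ≤ β⁻¹ ^ ⌈Real.log (100 * k ^ 2) / B⌉₊ := by
      rw [← Real.log_le_log_iff (by positivity) (by positivity), Real.log_pow,
        ← div_le_iff₀ hBpos]
      exact Nat.le_ceil _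
    have hβt : 0 < β ^ ⌈Real.log (100 * k ^ 2) / B⌉₊ := by positivity
    rw [inv_pow, ← one_div, le_div_iff₀ hβt] at hpow
    have : (⌈k⌉₊ : ℝ) ^ 2 ≤ (2 * k) ^ 2 := by gcongr
    nlinarith
  · have hlk : l ≤ Real.logb 2 k := Real.logb_le_logb_of_le (by norm_num) (by norm_num) hk32
    have hlog : Real.log (100 * k ^ 2) = Real.log 100 + 2 * (Real.log 2 * Real.logb 2 k) := by
      rw [Real.log_mul (by norm_num) (by positivity), Real.log_pow, Real.logb]
      have : Real.log 2 ≠ 0 := (Real.log_pos (by norm_num)).ne'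
      field_simp
      push_cast
      ring
    have h100 : 0 < Real.log 100 := Real.log_pos (by norm_num)
    have hnn : 0 ≤ Real.log (100 * k ^ 2) / B :=
      div_nonneg (Real.log_nonneg (by nlinarith)) hBpos.le
    refine (Nat.ceil_lt_add_one hnn).le.trans ?_
    have h1 : Real.log 100 / B + 1 ≤ (Real.log 100 / B + 1) / l * Real.logb 2 k := by
      rw [div_mul_eq_mul_div, le_div_iff₀ hlpos]
      gcongr
    rw [hlog, add_mul]
    have h2 : (Real.log 100 + 2 * (Real.log 2 * Real.logb 2 k)) / B =
        Real.log 100 / B + 2 * Real.log 2 / B * Real.logb 2 k := by ring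
    rw [h2]
    linarith

/-- Since R ≥ 3 excludes d = 0, the extra 1 from the factor 2 is absorbed into a multiple of d. -/
theorem logb_le_of_card_le {R : ℝ} (hR : 3 ≤ R) {d : ℕ} (h : R ≤ 2 * 2 ^ d) :
    Real.logb 2 R ≤ 3 * d := by
  have hd : Real.logb 2 R ≤ 1 + d := by
    rw [Real.logb_le_iff_le_rpow (by norm_num) (by linarith), Real.rpow_add (by norm_num),
      Real.rpow_one, Real.rpow_natCast]
    exact h
  have : 1 ≤ d := by
    rcases Nat.eq_zero_or_pos d with rfl | hd
    · norm_num at h; linarith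
    · exact hd
  have : (1 : ℝ) ≤ d := by exact_mod_cast this
  linarith

theorem theorem2 (ε : ℝ) (hε0 : 0 < ε) (hε : ε < 1 / 2) :
    ∃ c : ℝ, 0 < c ∧ ∀ (m n : ℕ) (f : Bits m → Bits n → Bool),
      c * rowBound f ≤ (quantumOneWay ε f : ℝ) := by
  have hβ0 : 0 < 2 * Real.sqrt (ε * (1 - ε)) := by
    have : 0 < 1 - ε := by linarith
    positivity
  have hβ1 : 2 * Real.sqrt (ε * (1 - ε)) < 1 := by
    have : Real.sqrt (ε * (1 - ε)) < 1 / 2 := by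
      rw [Real.sqrt_lt' (by norm_num)]
      nlinarith [sq_pos_of_pos (sub_pos.mpr hε)]
    linarith
  obtain ⟨A, hA, hrep⟩ := exists_repetitions hβ0 hβ1
  refine ⟨1 / (3 * A), by positivity, fun m n f => ?_⟩
  -- The trivial protocol makes the set nonempty, so its infimum is attained and is not the default
  -- value 0.
  obtain ⟨P, hP⟩ : quantumOneWay ε f ∈
      {C : ℕ | ∃ P : OneWayProtocol (Bits m) (Bits n) C, P.Computes ε f} :=
    Nat.sInf_mem ⟨m, exists_computes f hε0.le⟩
  set C := quantumOneWay ε f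
  rw [div_mul_eq_mul_div, one_mul, div_le_iff₀ (by positivity)]
  -- The nonnegativity condition covers an empty set of candidates, whose supremum is 0 by
  -- convention.
  refine Real.sSup_le ?_ (by positivity)
  rintro _ ⟨M', hM', h3, rfl⟩
  have hleast := splitBalance_isLeast M' (by omega)
  have hhalf := half_le_of_splitsWithin (by omega) hleast.1
  have hlt := splitBalance_lt_one (M' := M') (by omega)
  have hR : (3 : ℝ) ≤ M'.card := by exact_mod_cast h3
  have hk := logb_three_le_logb_splitBalance h3
  obtain ⟨t, ht, htA⟩ := hrep _ hk
  have hcard := card_le_of_computes hP hε0 hε hM' (by linarith) hleast.1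
    (card_mul_pow_ceil_le_one (by linarith) hlt (by linarith)) ht
  have hlog := logb_le_of_card_le hR hcard
  have hk1 : 1 < Real.logb (1 / splitBalance M') M'.card := by
    refine lt_of_lt_of_le ?_ hk
    rw [Real.lt_logb_iff_rpow_lt (by norm_num) (by norm_num)]
    norm_num
  rw [rowsBound, div_le_iff₀ (Real.logb_pos (by norm_num) hk1)]
  push_cast at hlog
  calc Real.logb 2 M'.card ≤ 3 * (C * t) := hlog
    _ ≤ 3 * (C * (A * Real.logb 2 (Real.logb (1 / splitBalance M') M'.card))) := by gcongr
    _ = _ := by ring
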